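/- Let $q$ be a prime power and $n\ge 1$. A cap in the projective space $\mathrm{PG}(n,q)$ over $\mathbb F_q$ is a set $\mathcal C$ of points no three of which are collinear; a secant of $\mathcal C$ is a line meeting $\mathcal C$ in precisely two points; an exterior point of $\mathcal C$ is a point of $\mathrm{PG}(n,q)$ not in $\mathcal C$. For an exterior point $p$ let $h_p$ be the number of secants of $\mathcal C$ through $p$, and let $\mathrm{Var}(h_p)$ be the variance of $h_p$ for $p$ chosen uniformly at random among the exterior points of $\mathcal C$. Consider a family $(\mathcal C_i)_{i\in I}$ of caps, $\mathcal C_i$ a cap of size $t=t_i$ in $\mathrm{PG}(n_i,q_i)$, together with real numbers $\sigma=\sigma_i\ge 0$. All asymptotic statements are along a fixed filter on $I$ (for instance, $I=\mathbb N$ and $i\to\infty$), and for nonnegative $f,g$ we write $f=\Omega(g)$ if there is a constant $c>0$ with $f\ge c\,g$ eventually, and $f=\Theta(g)$ if there are constants $c,c'>0$ with $c\,g\le f\le c'g$ eventually. An inequality $f\ge(1+o(1))g$ means that there are $\varepsilon_i\to0$ with $f_i\ge(1+\varepsilon_i)g_i$ eventually, and similarly for $\le$. (i) Let $n_i=n\ge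 4$ be fixed and $q=q_i\to\infty$. If $t=\Omega\bigl(q^{\frac56 n-\frac16}\bigr)$ and $\mathrm{Var}(h_p)\le\bigl(\tfrac14+o(1)\bigr)\sigma^2$, then $$\sigma\ \ge\ (1+o(1))\,t^3q^{-\frac52n+\frac12}.$$ (ii) Let $q_i=q\ge 3$ be fixed and $n=n_i\to\infty$. If $t=\Omega\bigl(q^{\frac56 n-\frac16}\bigr)$ and $\mathrm{Var}(h_p)=\Theta(\sigma^2)$, then $$\sigma=\Omega\bigl(t^3q^{-\frac52 n}\bigr).$$ -/

import Mathlib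

open Filter Topology Asymptotics
open scoped LinearAlgebra.Projectivization

namespace CapBound

/-- `PG(n, F)`, the `n`-dimensional projective space over `F`. -/
abbrev PG (n : ℕ) (F : Type*) [Field F] : Type _ := ℙ F (Fin (n + 1) → F)

variable {n : ℕ} {F : Type*} [Field F]

/-- Lines of `PG(n, F)` are the two-dimensional subspaces of `F ^ (n + 1)`. -/
def IsLine (W : Submodule F (Fin (n + 1) → F)) : Prop := Module.finrank F W = 2

/-- The point `p` lies on the line (or larger subspace) `W`. -/
def LiesOn (p : PG n F) (W : Submodule F (Fin (n + 1) → F)) : Prop := p.submodule ≤ W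

/-- A cap: a set of points, no three (distinct) of which are collinear. -/
def IsCap (C : Set (PG n F)) : Prop :=
  ∀ a ∈ C, ∀ b ∈ C, ∀ c ∈ C, a ≠ b → a ≠ c → b ≠ c →
    ¬ ∃ W : Submodule F (Fin (n + 1) → F), IsLine W ∧ LiesOn a W ∧ LiesOn b W ∧ LiesOn c W

/-- A secant of `C`: a line that meets `C` in precisely two points. -/
def IsSecant (C : Set (PG n F)) (W : Submodule F (Fin (n + 1) → F)) : Prop :=
  IsLine W ∧ {p | p ∈ C ∧ LiesOn p W}.ncard = 2

/-- The exterior points of `C`: the points not in `C`. -/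
def exteriorPoints (C : Set (PG n F)) : Set (PG n F) := Cᶜ

/-- `h_p`, the number of secants of `C` through the point `p`. -/
noncomputable def secantCount (C : Set (PG n F)) (p : PG n F) : ℕ :=
  {W : Submodule F (Fin (n + 1) → F) | IsSecant C W ∧ LiesOn p W}.ncard

/-- `h`, the expected number of secants through a uniformly random exterior point. -/
noncomputable def meanSecantCount (C : Set (PG n F)) : ℝ :=
  (∑ᶠ p ∈ exteriorPoints C, (secantCount C p : ℝ)) / (exteriorPoints C).ncard

/-- `Var(h_p)`, the variance of `h_p` for a uniformly random exterior point `p`. -/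
noncomputable def varSecantCount (C : Set (PG n F)) : ℝ :=
  (∑ᶠ p ∈ exteriorPoints C, ((secantCount C p : ℝ) - meanSecantCount C) ^ 2) /
    (exteriorPoints C).ncard

end CapBound

/-! Replace the cap by the set `A` of nonzero vectors above it in `G = F^(n+1)`, and write `k = |A|
= (q - 1) t`, `N = |G| = q^(n+1)`. Since no three points of the cap are collinear, the number of
ordered representations of `v` as a sum of two elements of `A` is `k` at `v = 0`, exactly `q - 2` on
`A`, and `2 h_p` at a vector above an exterior point `p`. As `A = -A`, its Fourier coefficients
`s(χ)` are real. Two facts about them conflict when the variance is small.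

Small variance bounds the coefficients above. Squaring `s(χ)` is taking the transform of the
representation function. Replacing `2 h_p` by its mean `M` costs at most `U`, the total deviation
over exterior vectors, and gives `s (s + M - (q - 2)) ≤ k - M + U` for `χ ≠ 1`. As `M` is about `k²
/ N`, every nontrivial coefficient is at most about `(k + U) N / k²` (`re_charSum_mul_le`).

Few representations on `A` force large coefficients. The second and third moments of `s` produce a
character `ψ` with `s(ψ) < -L₀`, where `L₀` is about `k² / N`. The correlation `∑ s(χ)² s(ψ χ⁻¹) = N
(q - 2) s(ψ)` contains the very negative term `k² s(ψ)`, which can be balanced only by positive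
coefficients (`mul_le_of_re_charSum_le`). The term `χ = ψ` cannot do it, because `s ≥ -t ≥ -k/2`
when `q ≥ 3`.

Together these give `k⁵ ≤ 16 U N³`. Cauchy-Schwarz gives `U² ≤ 4 N² Var`, so `Var` is at least of
order `t^10 q^(2 - 8n)`. For `t` in the assumed range this exceeds the required `t⁶ q^(1 - 5n)` by a
power of `q^(n+1)`, and that surplus pays for every constant lost on the way. -/

namespace CapBound

/-! ### Fourier coefficients of a symmetric set in a finite abelian group -/

section Fourier

variable {G : Type*} [AddCommGroup G]

/-- The number of ordered pairs of elements of `A` with sum `v`. -/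
def sumReps [DecidableEq G] (A : Finset G) (v : G) : ℕ :=
  ((A ×ˢ A).filter fun p => p.1 + p.2 = v).card

lemma sumReps_zero [DecidableEq G] (A : Finset G) (hA : ∀ a ∈ A, -a ∈ A) :
    sumReps A 0 = A.card := by
  unfold sumReps
  refine Finset.card_bij' (fun p _ => p.1) (fun a _ => (a, -a)) ?_ ?_ ?_ ?_
  · intro p hp
    exact (Finset.mem_product.1 (Finset.mem_filter.1 hp).1).1
  · intro a ha
    simp [ha, hA a ha]
  · rintro ⟨a, b⟩ hp
    have := (Finset.mem_filter.1 hp).2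
    simp only [Prod.mk.injEq, true_and]
    exact neg_eq_of_add_eq_zero_right this
  · intro a _; rfl

/-- The Fourier coefficient of the indicator function of `A` at `χ`. -/
noncomputable def charSum (A : Finset G) (χ : AddChar G ℂ) : ℂ := ∑ a ∈ A, χ a

lemma charSum_one (A : Finset G) : charSum A 1 = A.card := by simp [charSum]

lemma charSum_sq [DecidableEq G] [Fintype G] (A : Finset G) (χ : AddChar G ℂ) :
    charSum A χ ^ 2 = ∑ v, (sumReps A v : ℂ) * χ v := by
  have h : ∀ v, (sumReps A v : ℂ) * χ v =
      ∑ p ∈ (A ×ˢ A).filter (fun p => p.1 + p.2 = v), χ p.1 * χ p.2 := by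
    intro v
    rw [sumReps, ← nsmul_eq_mul, ← Finset.sum_const]
    refine Finset.sum_congr rfl fun p hp => ?_
    rw [← (Finset.mem_filter.1 hp).2, AddChar.map_add_eq_mul]
  simp_rw [h]
  rw [Finset.sum_fiberwise, Finset.sum_product, sq, charSum, Finset.sum_mul_sum]

/-- Parseval in bilinear form, by orthogonality of characters. It yields both the second moment of
the coefficients and their correlation with a shift. -/
lemma sum_fourier_mul_fourier_inv [Fintype G] (f g : G → ℂ) :
    ∑ χ : AddChar G ℂ, (∑ v, f v * χ v) * (∑ c, g c * χ⁻¹ c) =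
      Fintype.card G * ∑ v, f v * g v := by
  classical
  have h : ∀ χ : AddChar G ℂ, (∑ v, f v * χ v) * (∑ c, g c * χ⁻¹ c) =
      ∑ v, ∑ c, f v * g c * χ (v - c) := by
    intro χ
    rw [Finset.sum_mul_sum]
    refine Finset.sum_congr rfl fun v _ => Finset.sum_congr rfl fun c _ => ?_
    rw [AddChar.inv_apply, sub_eq_add_neg, AddChar.map_add_eq_mul]
    ring
  simp_rw [h]
  rw [Finset.sum_comm, Finset.mul_sum]
  refine Finset.sum_congr rfl fun v _ => ?_
  rw [Finset.sum_comm]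
  simp_rw [← Finset.mul_sum, AddChar.sum_apply_eq_ite, sub_eq_zero, mul_ite, mul_zero]
  rw [Finset.sum_ite_eq]
  simp only [Finset.mem_univ, if_true]
  ring

lemma charSum_eq_sum_ite [DecidableEq G] [Fintype G] (A : Finset G) (χ : AddChar G ℂ) :
    charSum A χ = ∑ v, (if v ∈ A then 1 else 0) * χ v := by
  simp [charSum]

lemma charSum_inv (A : Finset G) (hA : ∀ a ∈ A, -a ∈ A) (χ : AddChar G ℂ) :
    charSum A χ⁻¹ = charSum A χ := by
  unfold charSum
  exact Finset.sum_bij' (fun a _ => -a) (fun a _ => -a) hA hA (by simp) (by simp)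
    (by simp [AddChar.inv_apply])

lemma charSum_eq_ofReal [Finite G] (A : Finset G) (hA : ∀ a ∈ A, -a ∈ A) (χ : AddChar G ℂ) :
    charSum A χ = ((charSum A χ).re : ℂ) := by
  have h : (starRingEnd ℂ) (charSum A χ) = charSum A χ := by
    conv_rhs => rw [← charSum_inv A hA χ]
    simp [charSum, AddChar.inv_apply, AddChar.map_neg_eq_conj]
  exact (Complex.conj_eq_iff_re.1 h).symm

lemma sum_re_charSum_sq [Fintype G] (A : Finset G) (hA : ∀ a ∈ A, -a ∈ A) :
    ∑ χ : AddChar G ℂ, (charSum A χ).re ^ 2 = Fintype.card G * A.card := by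
  classical
  have h := sum_fourier_mul_fourier_inv (G := G)
    (fun v => if v ∈ A then 1 else 0) (fun v => if v ∈ A then 1 else 0)
  simp_rw [← charSum_eq_sum_ite, charSum_inv A hA] at h
  apply Complex.ofReal_injective
  push_cast
  simp_rw [← charSum_eq_ofReal A hA]
  simpa [sq] using h

/-- Parseval applied to the representation function and to `ψ` restricted to `A`: only
representations of elements of `A` enter, and there the count is the constant `r`. At `ψ = 1` this
is the third moment. -/
lemma sum_re_charSum_sq_mul [Fintype G] [DecidableEq G] (A : Finset G) (hA : ∀ a ∈ A, -a ∈ A)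
    {r : ℕ} (hr : ∀ v ∈ A, sumReps A v = r) (ψ : AddChar G ℂ) :
    ∑ χ : AddChar G ℂ, (charSum A χ).re ^ 2 * (charSum A (ψ * χ⁻¹)).re =
      Fintype.card G * r * (charSum A ψ).re := by
  have h := sum_fourier_mul_fourier_inv (G := G)
    (fun v => (sumReps A v : ℂ)) (fun v => if v ∈ A then ψ v else 0)
  have h1 : ∀ χ : AddChar G ℂ,
      ∑ c, (if c ∈ A then ψ c else 0) * χ⁻¹ c = charSum A (ψ * χ⁻¹) := by
    intro χ
    simp [charSum, AddChar.mul_apply]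
  have h2 : ∑ v, (sumReps A v : ℂ) * (if v ∈ A then ψ v else 0) = r * charSum A ψ := by
    simp only [mul_ite, mul_zero, Finset.sum_ite_mem, Finset.univ_inter, charSum, Finset.mul_sum]
    exact Finset.sum_congr rfl fun v hv => by rw [hr v hv]
  simp_rw [h1, ← charSum_sq, h2] at h
  apply Complex.ofReal_injective
  push_cast
  simp_rw [← charSum_eq_ofReal A hA]
  rw [h, mul_assoc]

/-- If every element of a symmetric set `A` has exactly `r` representations as a sum of two elements
of `A`, then its nontrivial Fourier coefficients cannot all be small from above. -/
theorem mul_le_of_re_charSum_le [Fintype G] [DecidableEq G] (A : Finset G)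
    (hA : ∀ a ∈ A, -a ∈ A) {r : ℕ} (hr : ∀ v ∈ A, sumReps A v = r) {e : ℝ} (he : 0 ≤ e)
    (hup : ∀ χ : AddChar G ℂ, χ ≠ 1 → (charSum A χ).re ≤ e)
    (hlow : ∀ χ : AddChar G ℂ, χ ≠ 1 → -(A.card / 2 : ℝ) ≤ (charSum A χ).re)
    (hk : 2 * (Fintype.card G * r : ℝ) < (A.card : ℝ) ^ 2) :
    ((A.card : ℝ) ^ 2 - Fintype.card G * r) * ((A.card : ℝ) ^ 2 / 2 - Fintype.card G * r) ≤
      e * Fintype.card G ^ 2 * A.card := by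
  set k : ℝ := (A.card : ℝ) with hkdef
  set N : ℝ := (Fintype.card G : ℝ) with hN
  set s : AddChar G ℂ → ℝ := fun χ => (charSum A χ).re with hs
  have hN0 : 0 < N := by rw [hN]; exact_mod_cast Fintype.card_pos
  have hr0 : (0 : ℝ) ≤ r := Nat.cast_nonneg r
  have hNr : 0 ≤ N * r := by positivity
  have hk0 : 0 ≤ k := Nat.cast_nonneg _
  have hkpos : 0 < k := by
    rcases hk0.eq_or_lt with h | h
    · rw [← h] at hk; nlinarith
    · exact h
  have hs1 : s 1 = k := by simp [hs, charSum_one, hkdef]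
  have hsq : ∑ χ, s χ ^ 2 = N * k := sum_re_charSum_sq A hA
  have hmul : ∀ ψ, ∑ χ, s χ ^ 2 * s (ψ * χ⁻¹) = N * r * s ψ := fun ψ =>
    sum_re_charSum_sq_mul A hA hr ψ
  -- Minus the average of `s` over all `χ ≠ 1` weighted by `s²`, up to replacing the total weight `N
  -- k - k²` by `N k`.
  set L₀ : ℝ := (k ^ 2 - N * r) / N with hL₀
  have hL₀N : L₀ * N = k ^ 2 - N * r := by rw [hL₀]; field_simp
  have hL₀pos : 0 < L₀ := div_pos (by nlinarith) hN0
  -- Otherwise `s² (s + L₀) ≥ 0` at every `χ ≠ 1`. Summing and isolating `χ = 1` gives `N r k + L₀ N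
  -- k ≥ k³ + L₀ k²`, while the left side equals `k³`.
  obtain ⟨ψ, hψ1, hψ⟩ : ∃ ψ : AddChar G ℂ, ψ ≠ 1 ∧ s ψ < -L₀ := by
    by_contra! hcon
    have h3 : ∑ χ, s χ ^ 2 * s χ = N * r * k := by
      rw [← hs1, ← hmul 1]
      refine Finset.sum_congr rfl fun χ _ => ?_
      simp only [hs, one_mul, charSum_inv A hA]
    have hterm : ∀ χ : AddChar G ℂ, (if χ = 1 then k ^ 3 + L₀ * k ^ 2 else 0) ≤
        s χ ^ 2 * s χ + L₀ * s χ ^ 2 := by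
      intro χ
      split_ifs with h
      · rw [h, hs1]; apply le_of_eq; ring
      · nlinarith [hcon χ h, sq_nonneg (s χ)]
    have hsum := Finset.sum_le_sum fun χ (_ : χ ∈ (Finset.univ : Finset (AddChar G ℂ))) => hterm χ
    rw [Finset.sum_add_distrib, ← Finset.mul_sum, hsq, h3, Finset.sum_ite_eq'] at hsum
    simp only [Finset.mem_univ, if_true] at hsum
    have : 0 < L₀ * k ^ 2 := by positivity
    nlinarith
  -- The upper bound `e` applies to `ψ χ⁻¹` unless `χ = ψ`; the terms `χ = 1` and `χ = ψ`, where a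
  -- factor `k` appears, are kept exactly.
  have hterm : ∀ χ : AddChar G ℂ, s χ ^ 2 * s (ψ * χ⁻¹) ≤
      e * s χ ^ 2 + (if χ = 1 then k ^ 2 * s ψ else 0) + (if χ = ψ then s ψ ^ 2 * k else 0) := by
    intro χ
    by_cases h1 : χ = 1
    · subst h1
      rw [if_pos rfl, if_neg (Ne.symm hψ1), hs1, inv_one, mul_one]
      nlinarith [mul_nonneg he (sq_nonneg k)]
    · by_cases h2 : χ = ψ
      · subst h2
        rw [if_neg h1, if_pos rfl, mul_inv_cancel, hs1]
        nlinarith [mul_nonneg he (sq_nonneg (s χ))]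
      · rw [if_neg h1, if_neg h2]
        have := hup (ψ * χ⁻¹) (fun h => h2 (mul_inv_eq_one.1 h).symm)
        nlinarith [mul_le_mul_of_nonneg_left this (sq_nonneg (s χ))]
  have hsum := Finset.sum_le_sum fun χ (_ : χ ∈ (Finset.univ : Finset (AddChar G ℂ))) => hterm χ
  rw [hmul, Finset.sum_add_distrib, Finset.sum_add_distrib, ← Finset.mul_sum, hsq,
    Finset.sum_ite_eq', Finset.sum_ite_eq'] at hsum
  simp only [Finset.mem_univ, if_true] at hsum
  have hlowψ := hlow ψ hψ1
  have h1 : L₀ * (k ^ 2 / 2 - N * r) ≤ e * (N * k) := by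
    -- The hypothesis `s ψ ≥ -k/2` keeps the `χ = ψ` term from cancelling more than half of the `χ =
    -- 1` term.
    have hb : k ^ 2 / 2 - N * r ≤ k ^ 2 + k * s ψ - N * r := by nlinarith
    have hb0 : 0 ≤ k ^ 2 / 2 - N * r := by linarith
    calc L₀ * (k ^ 2 / 2 - N * r) ≤ (-s ψ) * (k ^ 2 / 2 - N * r) :=
          mul_le_mul_of_nonneg_right (by linarith) hb0
      _ ≤ (-s ψ) * (k ^ 2 + k * s ψ - N * r) := mul_le_mul_of_nonneg_left hb (by linarith)
      _ ≤ e * (N * k) := by nlinarith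
  calc (k ^ 2 - N * r) * (k ^ 2 / 2 - N * r) = N * (L₀ * (k ^ 2 / 2 - N * r)) := by
        rw [← hL₀N]; ring
    _ ≤ N * (e * (N * k)) := mul_le_mul_of_nonneg_left h1 hN0.le
    _ = e * N ^ 2 * k := by ring

/-- The quadratic relation between a Fourier coefficient of `A` and the deviation from a constant `M`
of the number of representations outside `A ∪ {0}`. -/
theorem re_charSum_mul_le [Fintype G] [DecidableEq G] (A : Finset G)
    (hA : ∀ a ∈ A, -a ∈ A) (h0 : (0 : G) ∉ A) {r : ℕ} (hr : ∀ v ∈ A, sumReps A v = r) (M : ℝ)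
    {χ : AddChar G ℂ} (hχ : χ ≠ 1) :
    (charSum A χ).re * ((charSum A χ).re + M - r) ≤
      A.card - M + ∑ v ∈ (insert 0 A)ᶜ, |(sumReps A v : ℝ) - M| := by
  have hr0 := sumReps_zero A hA
  have hz : ∑ v, χ v = 0 := AddChar.sum_eq_zero_iff_ne_zero.2 hχ
  rw [← Finset.sum_add_sum_compl (insert 0 A), Finset.sum_insert h0, AddChar.map_zero_eq_one] at hz
  have hq := charSum_sq A χ
  rw [← Finset.sum_add_sum_compl (insert 0 A), Finset.sum_insert h0, AddChar.map_zero_eq_one,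
    hr0, Finset.sum_congr rfl (fun v hv => by rw [hr v hv]), ← Finset.mul_sum] at hq
  change 1 + charSum A χ + _ = 0 at hz
  change _ = _ + (r : ℂ) * charSum A χ + _ at hq
  -- The constant `M` is subtracted at the price of `M` times the character sum over the complement,
  -- which orthogonality evaluates as `-1 - charSum A χ`.
  have hE : ∑ v ∈ (insert 0 A)ᶜ, ((sumReps A v : ℂ) - M) * χ v =
      charSum A χ * (charSum A χ + M - r) - (A.card - M) := by
    simp_rw [sub_mul, Finset.sum_sub_distrib, ← Finset.mul_sum]
    linear_combination -hq - M * hz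
  have hn : ‖∑ v ∈ (insert 0 A)ᶜ, ((sumReps A v : ℂ) - M) * χ v‖ ≤
      ∑ v ∈ (insert 0 A)ᶜ, |(sumReps A v : ℝ) - M| := by
    refine (norm_sum_le _ _).trans (Finset.sum_le_sum fun v _ => ?_)
    rw [norm_mul, AddChar.norm_apply, mul_one, ← Real.norm_eq_abs, ← Complex.norm_real]
    push_cast
    exact le_rfl
  have hre := (Complex.re_le_norm _).trans hn
  rw [hE, charSum_eq_ofReal A hA] at hre
  have : ((((charSum A χ).re : ℝ) : ℂ) * (((charSum A χ).re : ℝ) + M - r) - (A.card - M)).re =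
      (charSum A χ).re * ((charSum A χ).re + M - r) - (A.card - M) := by
    norm_cast
  rw [this] at hre
  linarith

end Fourier

end CapBound

namespace CapBound

/-! ### Vectors above a set of projective points -/

section Cone

variable {n : ℕ} {F : Type*} [Field F]

instance [Finite F] : Finite (PG n F) := Projectivization.finite_of_finite F _

/-- The set of nonzero vectors representing a point of `S`. -/
noncomputable def cone [Finite F] (S : Set (PG n F)) : Finset (Fin (n + 1) → F) :=
  (Set.toFinite {v | ∃ h : v ≠ 0, Projectivization.mk F v h ∈ S}).toFinset

lemma mem_cone [Finite F] {S : Set (PG n F)} {v : Fin (n + 1) → F} :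
    v ∈ cone S ↔ ∃ h : v ≠ 0, Projectivization.mk F v h ∈ S := by
  simp [cone]

lemma zero_notMem_cone [Finite F] (S : Set (PG n F)) : (0 : Fin (n + 1) → F) ∉ cone S := by
  simp [mem_cone]

lemma mk_smul {c : F} (hc : c ≠ 0) {v : Fin (n + 1) → F} (hv : v ≠ 0) :
    Projectivization.mk F (c • v) (smul_ne_zero hc hv) = Projectivization.mk F v hv :=
  (Projectivization.mk_eq_mk_iff' F _ _ _ _).2 ⟨c, rfl⟩

lemma smul_mem_cone [Finite F] {S : Set (PG n F)} {c : F} (hc : c ≠ 0) {v : Fin (n + 1) → F}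
    (hv : v ∈ cone S) : c • v ∈ cone S := by
  obtain ⟨h, hS⟩ := mem_cone.1 hv
  exact mem_cone.2 ⟨smul_ne_zero hc h, by rwa [mk_smul hc h]⟩

lemma neg_mem_cone [Finite F] {S : Set (PG n F)} {v : Fin (n + 1) → F} (hv : v ∈ cone S) :
    -v ∈ cone S := by
  simpa using smul_mem_cone (neg_ne_zero.2 (one_ne_zero (α := F))) hv

lemma rep_mem_cone [Finite F] {S : Set (PG n F)} {p : PG n F} (hp : p ∈ S) : p.rep ∈ cone S :=
  mem_cone.2 ⟨p.rep_nonzero, by rwa [p.mk_rep]⟩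

lemma compl_insert_zero_cone [Fintype F] [DecidableEq F] (S : Set (PG n F)) :
    (insert 0 (cone S))ᶜ = cone Sᶜ := by
  ext v
  simp only [Finset.mem_compl, Finset.mem_insert, mem_cone, Set.mem_compl_iff]
  by_cases hv : v = 0 <;> simp [hv]

lemma sum_cone [Fintype F] [DecidableEq F] {M : Type*} [AddCommMonoid M] (S : Set (PG n F))
    (f : (Fin (n + 1) → F) → M) :
    ∑ v ∈ cone S, f v = ∑ p ∈ (Set.toFinite S).toFinset, ∑ u : Fˣ, f (u • p.rep) := by
  rw [← Finset.sum_product']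
  symm
  refine Finset.sum_bij (fun x _ => x.2 • x.1.rep) ?_ ?_ ?_ (fun _ _ => rfl)
  · rintro ⟨p, u⟩ hp
    exact smul_mem_cone u.ne_zero (rep_mem_cone (by simpa using hp))
  · rintro ⟨p, u⟩ _ ⟨p', u'⟩ _ h
    change (u : F) • p.rep = (u' : F) • p'.rep at h
    have hpp : p = p' := by
      rw [← p.mk_rep, ← p'.mk_rep, ← mk_smul u.ne_zero p.rep_nonzero,
        ← mk_smul u'.ne_zero p'.rep_nonzero]
      congr 1
    subst hpp
    rw [Units.ext (smul_left_injective F p.rep_nonzero h)]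
  · intro v hv
    obtain ⟨h, hS⟩ := mem_cone.1 hv
    obtain ⟨a, ha⟩ := Projectivization.exists_smul_eq_mk_rep F v h
    refine ⟨(Projectivization.mk F v h, a⁻¹), by simpa using hS, ?_⟩
    simp only
    rw [← ha, inv_smul_smul]

lemma card_units_eq_sub_one [Fintype F] [DecidableEq F] :
    (Fintype.card Fˣ : ℝ) = Fintype.card F - 1 := by
  rw [Fintype.card_units, Nat.cast_sub Fintype.card_pos, Nat.cast_one]

lemma sum_cone_eq_finsum [Fintype F] [DecidableEq F] (S : Set (PG n F))
    (f : (Fin (n + 1) → F) → ℝ) (g : PG n F → ℝ)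
    (hfg : ∀ v h, Projectivization.mk F v h ∈ S → f v = g (Projectivization.mk F v h)) :
    ∑ v ∈ cone S, f v = (Fintype.card F - 1) * ∑ᶠ p ∈ S, g p := by
  rw [sum_cone, finsum_mem_eq_finite_toFinset_sum g (Set.toFinite S), Finset.mul_sum]
  refine Finset.sum_congr rfl fun p hp => ?_
  have hp : p ∈ S := by simpa using hp
  have : ∀ u : Fˣ, f (u • p.rep) = g p := by
    intro u
    have h := mk_smul u.ne_zero p.rep_nonzero
    rw [p.mk_rep] at h
    have := hfg ((u : F) • p.rep) (smul_ne_zero u.ne_zero p.rep_nonzero) (by rwa [h])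
    rwa [h] at this
  simp [this, card_units_eq_sub_one]

lemma card_cone [Fintype F] [DecidableEq F] (S : Set (PG n F)) :
    ((cone S).card : ℝ) = (Fintype.card F - 1) * S.ncard := by
  have h := sum_cone_eq_finsum S (fun _ => 1) (fun _ => 1) (fun _ _ _ => rfl)
  rw [finsum_mem_eq_finite_toFinset_sum _ (Set.toFinite S)] at h
  rw [Set.ncard_eq_toFinset_card S]
  simpa using h

/-- On the line of multiples of a representative, a character is either trivial, contributing `q -
1`, or sums to zero, contributing `-1` once the zero vector is removed. Each point thus contributes
at least `-1`. -/
lemma neg_ncard_le_re_charSum_cone [Fintype F] [DecidableEq F] (S : Set (PG n F))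
    (χ : AddChar (Fin (n + 1) → F) ℂ) : -(S.ncard : ℝ) ≤ (charSum (cone S) χ).re := by
  rw [charSum, sum_cone, Complex.re_sum, Set.ncard_eq_toFinset_card S, ← nsmul_one, ← smul_neg,
    ← Finset.sum_const]
  refine Finset.sum_le_sum fun p _ => ?_
  let φ : AddChar F ℂ := χ.compAddMonoidHom (LinearMap.toSpanSingleton F _ p.rep).toAddMonoidHom
  have hφ : ∀ x : F, φ x = χ (x • p.rep) := fun x => rfl
  have h1 : ∑ u : Fˣ, χ (u • p.rep) = ∑ x : F, φ x - 1 := by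
    rw [← Finset.sum_erase_add _ _ (Finset.mem_univ (0 : F)), φ.map_zero_eq_one, add_sub_cancel_right]
    refine Finset.sum_bij (fun u _ => (u : F)) (by simp) (fun _ _ _ _ h => Units.ext h) ?_
      (fun _ _ => rfl)
    intro b hb
    exact ⟨Units.mk0 b (Finset.ne_of_mem_erase hb), Finset.mem_univ _, rfl⟩
  rw [h1, AddChar.sum_eq_ite]
  split_ifs
  · simp
  · simp

end Cone

/-! ### Representations as sums and secants of a cap -/

section Secants

variable {n : ℕ} {F : Type*} [Field F]

lemma pair_iff_mk_ne {v w : Fin (n + 1) → F} (hv : v ≠ 0) (hw : w ≠ 0) :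
    LinearIndependent F ![v, w] ↔ Projectivization.mk F v hv ≠ Projectivization.mk F w hw := by
  rw [LinearIndependent.pair_iff' hv, ne_comm, Ne, Projectivization.mk_eq_mk_iff']
  push Not
  rfl

lemma isLine_span_pair {v w : Fin (n + 1) → F} (h : LinearIndependent F ![v, w]) :
    IsLine (Submodule.span F {v, w}) := by
  have := finrank_span_eq_card h
  rwa [Matrix.range_cons_cons_empty, Fintype.card_fin] at this

lemma liesOn_mk {v : Fin (n + 1) → F} (hv : v ≠ 0) {W : Submodule F (Fin (n + 1) → F)} :
    LiesOn (Projectivization.mk F v hv) W ↔ v ∈ W := by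
  rw [LiesOn, Projectivization.submodule_mk, Submodule.span_singleton_le_iff_mem]

lemma IsLine.eq_span_pair {W : Submodule F (Fin (n + 1) → F)} (hW : IsLine W)
    {v w : Fin (n + 1) → F} (h : LinearIndependent F ![v, w]) (hv : v ∈ W) (hw : w ∈ W) :
    Submodule.span F {v, w} = W := by
  refine Submodule.eq_of_le_of_finrank_eq ?_ ((isLine_span_pair h).trans hW.symm)
  rw [Submodule.span_le]
  rintro x (rfl | rfl)
  exacts [hv, hw]

/-- The cap condition in vector form: with both coefficients nonzero, the combination would
represent a third cap point on the line through the other two. -/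
lemma IsCap.eq_zero_or_eq_zero [Finite F] {C : Set (PG n F)} (hC : IsCap C)
    {a b : Fin (n + 1) → F} (hab : LinearIndependent F ![a, b]) (ha : a ∈ cone C) (hb : b ∈ cone C)
    {α β : F} (hc : α • a + β • b ∈ cone C) : α = 0 ∨ β = 0 := by
  by_contra! h
  obtain ⟨ha0, haC⟩ := mem_cone.1 ha
  obtain ⟨hb0, hbC⟩ := mem_cone.1 hb
  obtain ⟨hc0, hcC⟩ := mem_cone.1 hc
  have hp := LinearIndependent.pair_iff.1 hab
  refine hC _ haC _ hbC _ hcC ((pair_iff_mk_ne ha0 hb0).1 hab) ?_ ?_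
    ⟨Submodule.span F {a, b}, isLine_span_pair hab, (liesOn_mk ha0).2 ?_, (liesOn_mk hb0).2 ?_,
      (liesOn_mk hc0).2 ?_⟩
  · rw [← pair_iff_mk_ne, LinearIndependent.pair_iff]
    intro s t hst
    have h1 : (s + t * α) • a + (t * β) • b = 0 := by rw [← hst]; module
    obtain ⟨h2, h3⟩ := hp _ _ h1
    have ht : t = 0 := (mul_eq_zero.1 h3).resolve_right h.2
    subst ht
    simpa using h2
  · rw [← pair_iff_mk_ne, LinearIndependent.pair_iff]
    intro s t hst
    have h1 : (t * α) • a + (s + t * β) • b = 0 := by rw [← hst]; module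
    obtain ⟨h2, h3⟩ := hp _ _ h1
    have ht : t = 0 := (mul_eq_zero.1 h2).resolve_right h.1
    subst ht
    simpa using h3
  · exact Submodule.subset_span (by simp)
  · exact Submodule.subset_span (by simp)
  · exact Submodule.mem_span_pair.2 ⟨α, β, rfl⟩

/-- Each vector over a cap is a sum of two such vectors only in the trivial ways. -/
lemma IsCap.sumReps_cone_of_mem [Fintype F] [DecidableEq F] {C : Set (PG n F)} (hC : IsCap C)
    {v : Fin (n + 1) → F} (hv : v ∈ cone C) : sumReps (cone C) v = Fintype.card F - 2 := by
  obtain ⟨hv0, -⟩ := mem_cone.1 hv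
  -- The representations are `v = α v + (1 - α) v`; both summands must be nonzero, which excludes `α
  -- = 0` and `α = 1`.
  have hcard : ((Finset.univ.erase (0 : F)).erase 1).card = Fintype.card F - 2 := by
    rw [Finset.card_erase_of_mem (by simp), Finset.card_erase_of_mem (by simp), Finset.card_univ,
      Nat.sub_sub]
  rw [← hcard, sumReps]
  symm
  refine Finset.card_bij (fun α _ => (α • v, (1 - α) • v)) ?_ ?_ ?_
  · intro α hα
    simp only [Finset.mem_erase, Finset.mem_univ, and_true] at hα
    refine Finset.mem_filter.2 ⟨Finset.mem_product.2 ⟨smul_mem_cone hα.2 hv,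
      smul_mem_cone (sub_ne_zero.2 (Ne.symm hα.1)) hv⟩, ?_⟩
    simp only
    module
  · intro α _ β _ h
    exact smul_left_injective F hv0 (Prod.mk.inj h).1
  · rintro ⟨a, b⟩ hab
    obtain ⟨hab, hsum⟩ := Finset.mem_filter.1 hab
    obtain ⟨ha, hb⟩ := Finset.mem_product.1 hab
    simp only at ha hb hsum
    obtain ⟨ha0, -⟩ := mem_cone.1 ha
    obtain ⟨hb0, -⟩ := mem_cone.1 hb
    have hdep : ¬ LinearIndependent F ![a, b] := by
      intro h
      have := hC.eq_zero_or_eq_zero h ha hb (α := 1) (β := 1) (by simpa [hsum] using hv)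
      simp at this
    rw [LinearIndependent.pair_iff' ha0] at hdep
    push Not at hdep
    obtain ⟨c, rfl⟩ := hdep
    have hv' : v = (1 + c) • a := by rw [← hsum]; module
    have hc1 : 1 + c ≠ 0 := by rintro h; rw [h, zero_smul] at hv'; exact hv0 hv'
    have hc0 : c ≠ 0 := by rintro rfl; simp at hb0
    refine ⟨(1 + c)⁻¹, ?_, ?_⟩
    · simpa [inv_eq_one, hc1] using hc0
    · have h1 : (1 + c)⁻¹ • v = a := by rw [hv', inv_smul_smul₀ hc1]
      rw [sub_smul, h1, one_smul, hv']
      refine Prod.ext rfl ?_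
      simp only
      module

/-- Over an exterior point, the representations as a sum count each secant twice. -/
lemma IsCap.sumReps_cone_of_notMem [Fintype F] [DecidableEq F] {C : Set (PG n F)} (hC : IsCap C)
    {v : Fin (n + 1) → F} (hv0 : v ≠ 0) (hv : v ∉ cone C) :
    sumReps (cone C) v = 2 * secantCount C (Projectivization.mk F v hv0) := by
  classical
  have hfin := Set.toFinite {W : Submodule F (Fin (n + 1) → F) |
    IsSecant C W ∧ LiesOn (Projectivization.mk F v hv0) W}
  rw [secantCount, Set.ncard_eq_toFinset_card _ hfin, sumReps, mul_comm, ← smul_eq_mul,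
    ← Finset.sum_const]
  -- Sort the pairs by the line they span. A secant through the point meets the cap in `x` and `y`,
  -- and `v = α x + β y` has unique nonzero coefficients, so its fibre is this pair in its two
  -- orders.
  rw [Finset.card_eq_sum_card_fiberwise (f := fun p => Submodule.span F {p.1, p.2})
    (t := hfin.toFinset)]
  · refine Finset.sum_congr rfl fun W hW => ?_
    obtain ⟨⟨hline, hcard⟩, hvW⟩ := hfin.mem_toFinset.1 hW
    rw [liesOn_mk] at hvW
    obtain ⟨x, y, hxy, hset⟩ := Set.ncard_eq_two.1 hcard
    have hx : x ∈ {p | p ∈ C ∧ LiesOn p W} := by rw [hset]; simp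
    have hy : y ∈ {p | p ∈ C ∧ LiesOn p W} := by rw [hset]; simp
    have hxW : x.rep ∈ W := by rw [← liesOn_mk x.rep_nonzero, x.mk_rep]; exact hx.2
    have hyW : y.rep ∈ W := by rw [← liesOn_mk y.rep_nonzero, y.mk_rep]; exact hy.2
    have hind : LinearIndependent F ![x.rep, y.rep] :=
      Projectivization.linearIndependent_pair_iff_ne.2 hxy
    have hp := LinearIndependent.pair_iff.1 hind
    rw [← hline.eq_span_pair hind hxW hyW] at hvW
    obtain ⟨α, β, rfl⟩ := Submodule.mem_span_pair.1 hvW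
    have hxC := rep_mem_cone hx.1
    have hyC := rep_mem_cone hy.1
    have hα : α ≠ 0 := by
      rintro rfl
      have hβ : β ≠ 0 := by rintro rfl; simp at hv0
      exact hv (by simpa using smul_mem_cone hβ hyC)
    have hβ : β ≠ 0 := by
      rintro rfl
      exact hv (by simpa using smul_mem_cone hα hxC)
    have huniq : ∀ γ δ : F, γ • x.rep + δ • y.rep = α • x.rep + β • y.rep → γ = α ∧ δ = β := by
      intro γ δ h
      have h1 : (γ - α) • x.rep + (δ - β) • y.rep = 0 := by
        rw [sub_smul, sub_smul]
        linear_combination (exp := 1) h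
      exact ⟨sub_eq_zero.1 (hp _ _ h1).1, sub_eq_zero.1 (hp _ _ h1).2⟩
    have hind' : LinearIndependent F ![α • x.rep, β • y.rep] := by
      rw [pair_iff_mk_ne (smul_ne_zero hα x.rep_nonzero) (smul_ne_zero hβ y.rep_nonzero),
        mk_smul hα x.rep_nonzero, mk_smul hβ y.rep_nonzero, x.mk_rep, y.mk_rep]
      exact hxy
    have hspan := hline.eq_span_pair hind' (W.smul_mem α hxW) (W.smul_mem β hyW)
    have hmul : ∀ a ∈ cone C, a ∈ W → (∃ γ : F, a = γ • x.rep) ∨ ∃ γ : F, a = γ • y.rep := by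
      intro a ha haW
      obtain ⟨ha0, haC⟩ := mem_cone.1 ha
      have : Projectivization.mk F a ha0 ∈ {p | p ∈ C ∧ LiesOn p W} :=
        ⟨haC, (liesOn_mk ha0).2 haW⟩
      rw [hset] at this
      refine this.imp (fun h => ?_) (fun h => ?_)
      all_goals
        obtain ⟨c, hc⟩ := (Projectivization.mk_eq_mk_iff' F _ _ ha0
          (Projectivization.rep_nonzero _)).1 (h.trans (Projectivization.mk_rep _).symm)
        exact ⟨c, hc.symm⟩
    rw [Finset.card_eq_two]
    refine ⟨(α • x.rep, β • y.rep), (β • y.rep, α • x.rep), ?_, ?_⟩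
    · intro h
      have h1 := (Prod.mk.inj h).1
      have := hp α (-β) (by rw [h1]; module)
      exact hα this.1
    · ext ⟨a, b⟩
      simp only [Finset.mem_filter, Finset.mem_product, Finset.mem_insert, Finset.mem_singleton,
        Prod.mk.injEq]
      constructor
      · rintro ⟨⟨⟨ha, hb⟩, hsum⟩, hs⟩
        have haW : a ∈ W := by rw [← hs]; exact Submodule.subset_span (by simp)
        have hbW : b ∈ W := by rw [← hs]; exact Submodule.subset_span (by simp)
        rcases hmul a ha haW with ⟨γ, rfl⟩ | ⟨γ, rfl⟩ <;>
          rcases hmul b hb hbW with ⟨δ, rfl⟩ | ⟨δ, rfl⟩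
        · exact absurd (huniq (γ + δ) 0 (by rw [← hsum]; module)).2.symm hβ
        · obtain ⟨rfl, rfl⟩ := huniq γ δ hsum
          exact Or.inl ⟨rfl, rfl⟩
        · obtain ⟨rfl, rfl⟩ := huniq δ γ (by rw [← hsum]; module)
          exact Or.inr ⟨rfl, rfl⟩
        · exact absurd (huniq 0 (γ + δ) (by rw [← hsum]; module)).1.symm hα
      · rintro (⟨rfl, rfl⟩ | ⟨rfl, rfl⟩)
        · exact ⟨⟨⟨smul_mem_cone hα hxC, smul_mem_cone hβ hyC⟩, rfl⟩, hspan⟩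
        · exact ⟨⟨⟨smul_mem_cone hβ hyC, smul_mem_cone hα hxC⟩, add_comm _ _⟩,
            by rw [Set.pair_comm]; exact hspan⟩
  · rintro ⟨a, b⟩ hab
    obtain ⟨hab, hsum⟩ := Finset.mem_filter.1 hab
    obtain ⟨ha, hb⟩ := Finset.mem_product.1 hab
    simp only at ha hb hsum
    obtain ⟨ha0, haC⟩ := mem_cone.1 ha
    obtain ⟨hb0, hbC⟩ := mem_cone.1 hb
    have hind : LinearIndependent F ![a, b] := by
      rw [LinearIndependent.pair_iff' ha0]
      rintro c rfl
      have hv' : v = (1 + c) • a := by rw [← hsum]; module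
      have hc1 : 1 + c ≠ 0 := by rintro h; rw [h, zero_smul] at hv'; exact hv0 hv'
      exact hv (hv' ▸ smul_mem_cone hc1 ha)
    have haW : a ∈ Submodule.span F {a, b} := Submodule.subset_span (by simp)
    have hbW : b ∈ Submodule.span F {a, b} := Submodule.subset_span (by simp)
    rw [hfin.coe_toFinset]
    refine ⟨⟨isLine_span_pair hind, ?_⟩, (liesOn_mk hv0).2 (hsum ▸ add_mem haW hbW)⟩
    rw [Set.ncard_eq_two]
    refine ⟨_, _, (pair_iff_mk_ne ha0 hb0).1 hind, ?_⟩
    ext p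
    simp only [Set.mem_ofPred_eq, Set.mem_insert_iff, Set.mem_singleton_iff]
    constructor
    · induction p using Projectivization.ind with
      | h c hc0 =>
        rintro ⟨hcC, hcW⟩
        obtain ⟨γ, δ, rfl⟩ := Submodule.mem_span_pair.1 ((liesOn_mk hc0).1 hcW)
        rcases hC.eq_zero_or_eq_zero hind ha hb (mem_cone.2 ⟨hc0, hcC⟩) with rfl | rfl
        · exact Or.inr ((Projectivization.mk_eq_mk_iff' F _ _ _ _).2 ⟨δ, by simp⟩)
        · exact Or.inl ((Projectivization.mk_eq_mk_iff' F _ _ _ _).2 ⟨γ, by simp⟩)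
    · rintro (rfl | rfl)
      · exact ⟨haC, (liesOn_mk ha0).2 haW⟩
      · exact ⟨hbC, (liesOn_mk hb0).2 hbW⟩

end Secants

end CapBound

namespace CapBound

/-! ### From Fourier coefficients to a lower bound for the variance -/

section Variance

variable {n : ℕ} {F : Type*} [Field F]

lemma sum_sumReps {G : Type*} [AddCommGroup G] [Fintype G] [DecidableEq G] (A : Finset G) :
    ∑ v, sumReps A v = A.card ^ 2 := by
  rw [sq, ← Finset.card_product]
  exact (Finset.card_eq_sum_card_fiberwise (f := fun p : G × G => p.1 + p.2)
    (t := Finset.univ) (fun _ _ => Finset.mem_univ _)).symm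

lemma IsCap.sumReps_cone_eq [Fintype F] [DecidableEq F] {C : Set (PG n F)} (hC : IsCap C)
    {v : Fin (n + 1) → F} (h : v ≠ 0) (hv : Projectivization.mk F v h ∈ exteriorPoints C) :
    (sumReps (cone C) v : ℝ) = 2 * secantCount C (Projectivization.mk F v h) := by
  rw [hC.sumReps_cone_of_notMem h (fun hmem => hv (mem_cone.1 hmem).2)]
  push_cast
  rfl

lemma card_mul_meanSecantCount [Finite F] (C : Set (PG n F)) :
    (exteriorPoints C).ncard * meanSecantCount C =
      ∑ᶠ p ∈ exteriorPoints C, (secantCount C p : ℝ) := by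
  rcases (exteriorPoints C).eq_empty_or_nonempty with h | h
  · simp [h]
  · have := (Set.ncard_pos (Set.toFinite _)).2 h
    rw [meanSecantCount, mul_div_cancel₀]
    positivity

lemma card_mul_varSecantCount [Finite F] (C : Set (PG n F)) :
    (exteriorPoints C).ncard * varSecantCount C =
      ∑ᶠ p ∈ exteriorPoints C, ((secantCount C p : ℝ) - meanSecantCount C) ^ 2 := by
  rcases (exteriorPoints C).eq_empty_or_nonempty with h | h
  · simp [h]
  · have := (Set.ncard_pos (Set.toFinite _)).2 h
    rw [varSecantCount, mul_div_cancel₀]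
    positivity

lemma meanSecantCount_nonneg (C : Set (PG n F)) : 0 ≤ meanSecantCount C :=
  div_nonneg (finsum_nonneg fun _ => finsum_nonneg fun _ => Nat.cast_nonneg _) (Nat.cast_nonneg _)

lemma varSecantCount_nonneg (C : Set (PG n F)) : 0 ≤ varSecantCount C :=
  div_nonneg (finsum_nonneg fun _ => finsum_nonneg fun _ => sq_nonneg _) (Nat.cast_nonneg _)

/-- The mean number of secants, from counting all pairs of vectors over the cap. -/
lemma IsCap.meanSecantCount_eq [Fintype F] [DecidableEq F] {C : Set (PG n F)} (hC : IsCap C) :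
    (cone (exteriorPoints C)).card * (2 * meanSecantCount C) =
      ((cone C).card : ℝ) ^ 2 - (cone C).card * (Fintype.card F - 1) := by
  have hq : 2 ≤ Fintype.card F := Fintype.one_lt_card
  have h1 : ∑ v ∈ cone (exteriorPoints C), (sumReps (cone C) v : ℝ) =
      (cone (exteriorPoints C)).card * (2 * meanSecantCount C) := by
    rw [sum_cone_eq_finsum (exteriorPoints C) _ (fun p => 2 * (secantCount C p : ℝ))
      (fun v h hv => hC.sumReps_cone_eq h hv), ← mul_finsum_mem,
      ← card_mul_meanSecantCount, card_cone]
    ring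
  have h2 : ∑ v, (sumReps (cone C) v : ℝ) = ((cone C).card : ℝ) ^ 2 := by
    exact_mod_cast sum_sumReps (cone C)
  have h0 : sumReps (cone C) (0 : Fin (n + 1) → F) = (cone C).card :=
    sumReps_zero _ (fun _ => neg_mem_cone)
  rw [← Finset.sum_add_sum_compl (insert 0 (cone C)), compl_insert_zero_cone,
    Finset.sum_insert (zero_notMem_cone C), h0, Finset.sum_congr rfl
    (fun v hv => by rw [hC.sumReps_cone_of_mem hv]), Finset.sum_const, nsmul_eq_mul,
    Nat.cast_sub hq] at h2
  change _ + ∑ v ∈ cone (exteriorPoints C), _ = _ at h2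
  rw [h1] at h2
  push_cast at h2
  linarith

/-- The total deviation over the exterior vectors is controlled by the variance. -/
lemma IsCap.sq_sum_abs_sub_le [Fintype F] [DecidableEq F] {C : Set (PG n F)} (hC : IsCap C) :
    (∑ v ∈ (insert 0 (cone C))ᶜ, |(sumReps (cone C) v : ℝ) - 2 * meanSecantCount C|) ^ 2 ≤
      4 * ((Fintype.card F : ℝ) ^ (n + 1)) ^ 2 * varSecantCount C := by
  rw [compl_insert_zero_cone]
  change (∑ v ∈ cone (exteriorPoints C), _) ^ 2 ≤ _
  have h1 : ∑ v ∈ cone (exteriorPoints C),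
      |(sumReps (cone C) v : ℝ) - 2 * meanSecantCount C| ^ 2 =
      4 * (cone (exteriorPoints C)).card * varSecantCount C := by
    rw [sum_cone_eq_finsum (exteriorPoints C) _
      (fun p => 4 * ((secantCount C p : ℝ) - meanSecantCount C) ^ 2)
      (fun v h hv => by rw [hC.sumReps_cone_eq h hv, sq_abs]; ring),
      ← mul_finsum_mem, ← card_mul_varSecantCount, card_cone]
    ring
  have hcard : ((cone (exteriorPoints C)).card : ℝ) ≤ (Fintype.card F : ℝ) ^ (n + 1) := by
    have := Finset.card_le_univ (cone (exteriorPoints C))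
    rw [Fintype.card_fun, Fintype.card_fin] at this
    exact_mod_cast this
  refine sq_sum_le_card_mul_sum_sq.trans ?_
  rw [h1]
  have hv := varSecantCount_nonneg C
  calc _ = 4 * ((cone (exteriorPoints C)).card : ℝ) ^ 2 * varSecantCount C := by ring
    _ ≤ _ := by gcongr

/-- The numerical estimate behind `IsCap.card_cone_pow_le`. -/
lemma pow_five_le {k N D q U : ℝ} (hk : 0 < k) (hN : 0 < N) (hD : 0 < D)
    (h2 : 8 * N * q ≤ k ^ 2) (h4 : 16 * N ^ 3 ≤ k ^ 4) (hDN : 3 / 4 * k ^ 2 ≤ D * N)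
    (hmain : (k ^ 2 - N * (q - 2)) * (k ^ 2 / 2 - N * (q - 2)) ≤ (k + U) / D * N ^ 2 * k) :
    k ^ 5 ≤ 16 * (U * N ^ 3) := by
  have hk2 : 0 < k ^ 2 := by positivity
  have hx : 7 / 8 * k ^ 2 ≤ k ^ 2 - N * (q - 2) := by nlinarith
  have hy : 3 / 8 * k ^ 2 ≤ k ^ 2 / 2 - N * (q - 2) := by nlinarith
  have hxy := (mul_le_mul hx hy (by positivity) (by linarith)).trans hmain
  have hz : 21 / 64 * k ^ 3 * D ≤ (k + U) * N ^ 2 := by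
    have h3 := mul_le_mul_of_nonneg_right hxy hD.le
    have : (k + U) / D * N ^ 2 * k * D = (k + U) * N ^ 2 * k := by field_simp
    rw [this] at h3
    refine le_of_mul_le_mul_right ?_ hk
    calc _ = 7 / 8 * k ^ 2 * (3 / 8 * k ^ 2) * D := by ring
      _ ≤ _ := h3
  have h5 : 63 / 256 * k ^ 5 ≤ (k + U) * N ^ 3 := by
    calc 63 / 256 * k ^ 5 = 21 / 64 * k ^ 3 * (3 / 4 * k ^ 2) := by ring
      _ ≤ 21 / 64 * k ^ 3 * (D * N) := by gcongr
      _ = 21 / 64 * k ^ 3 * D * N := by ring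
      _ ≤ (k + U) * N ^ 2 * N := by gcongr
      _ = _ := by ring
  have h7 := mul_le_mul_of_nonneg_right h4 hk.le
  have h8 : 0 ≤ k ^ 5 := by positivity
  -- By `h7`, `k N³ ≤ k⁵ / 16`, so the `k` in `k + U` is absorbed on the left; `63/256 - 1/16 =
  -- 47/256` exceeds `1/16`.
  linarith

/-- A lower bound for the variance in terms of the number of vectors over the cap. -/
theorem IsCap.card_cone_pow_le [Fintype F] [DecidableEq F] {C : Set (PG n F)} (hC : IsCap C)
    (hq : 3 ≤ Fintype.card F)
    (h2 : 8 * (Fintype.card F : ℝ) ^ (n + 1) * Fintype.card F ≤ ((cone C).card : ℝ) ^ 2)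
    (h4 : 16 * ((Fintype.card F : ℝ) ^ (n + 1)) ^ 3 ≤ ((cone C).card : ℝ) ^ 4) :
    ((cone C).card : ℝ) ^ 10 ≤ 1024 * ((Fintype.card F : ℝ) ^ (n + 1)) ^ 8 * varSecantCount C := by
  set k : ℝ := ((cone C).card : ℝ) with hk
  set q : ℝ := (Fintype.card F : ℝ) with hqdef
  set N : ℝ := q ^ (n + 1) with hN
  set M : ℝ := 2 * meanSecantCount C with hM
  set U : ℝ := ∑ v ∈ (insert 0 (cone C))ᶜ, |(sumReps (cone C) v : ℝ) - M| with hU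
  have hq3 : (3 : ℝ) ≤ q := by rw [hqdef]; exact_mod_cast hq
  have hN0 : 0 < N := by positivity
  have hk0 : 0 ≤ k := Nat.cast_nonneg _
  have hU0 : 0 ≤ U := Finset.sum_nonneg fun _ _ => abs_nonneg _
  have hM0 : 0 ≤ M := mul_nonneg zero_le_two (meanSecantCount_nonneg C)
  have hU2 : U ^ 2 ≤ 4 * N ^ 2 * varSecantCount C := hC.sq_sum_abs_sub_le
  have hcardN : (Fintype.card (Fin (n + 1) → F) : ℝ) = N := by simp [hN, hqdef]
  have hkN : k ≤ N := by rw [← hcardN, hk]; exact_mod_cast Finset.card_le_univ (cone C)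
  have hkpos : 0 < k := by
    rcases hk0.eq_or_lt with h | h
    · rw [← h] at h2
      have : 0 < 8 * N * q := by positivity
      linarith
    · exact h
  have hkq : 8 * q ≤ k := by
    have h : 8 * q * N ≤ k * N := by nlinarith
    exact le_of_mul_le_mul_right h hN0
  have hMN : k ^ 2 - k * (q - 1) ≤ M * N := by
    rw [← hC.meanSecantCount_eq, mul_comm, ← hcardN]
    exact mul_le_mul_of_nonneg_left (by exact_mod_cast Finset.card_le_univ _) hM0
  have hr : ((Fintype.card F - 2 : ℕ) : ℝ) = q - 2 := by
    rw [Nat.cast_sub (by omega)]; rfl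
  -- The linear coefficient in the quadratic relation. It is comparable to `k² / N`, since `k q` and
  -- `N q` are each at most `k² / 8`.
  set D : ℝ := M - (q - 2) with hD
  have hDN : 3 / 4 * k ^ 2 ≤ D * N := by
    have : D * N = M * N - q * N + 2 * N := by rw [hD]; ring
    nlinarith
  have hDpos : 0 < D := by
    have : 0 < D * N := lt_of_lt_of_le (by positivity) hDN
    exact pos_of_mul_pos_left this hN0.le
  have hkt : k = (q - 1) * C.ncard := card_cone C
  have hmain := mul_le_of_re_charSum_le (cone C) (fun _ => neg_mem_cone)
    (fun v hv => hC.sumReps_cone_of_mem hv) (e := (k + U) / D) (by positivity) ?_ ?_ ?_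
  · rw [hcardN, hr] at hmain
    have h6 := pow_five_le hkpos hN0 hDpos h2 h4 hDN hmain
    calc k ^ 10 = (k ^ 5) ^ 2 := by ring
      _ ≤ (16 * (U * N ^ 3)) ^ 2 := by gcongr
      _ = 256 * N ^ 6 * U ^ 2 := by ring
      _ ≤ 256 * N ^ 6 * (4 * N ^ 2 * varSecantCount C) := by gcongr
      _ = _ := by ring
  · intro χ hχ
    have h := re_charSum_mul_le (cone C) (fun _ => neg_mem_cone) (zero_notMem_cone C)
      (fun v hv => hC.sumReps_cone_of_mem hv) M hχ
    rw [hr] at h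
    rw [le_div_iff₀ hDpos]
    change _ ≤ k - M + U at h
    -- Only nonnegative coefficients need the quadratic relation; there the square and `M` are
    -- simply dropped.
    rcases le_total (charSum (cone C) χ).re 0 with hs | hs
    · nlinarith [mul_nonneg (neg_nonneg.2 hs) hDpos.le]
    · nlinarith [mul_nonneg hs hs]
  · intro χ _
    refine le_trans (neg_le_neg ?_) (neg_ncard_le_re_charSum_cone C χ)
    change _ ≤ k / 2
    -- Here `q ≥ 3` is essential: `k = (q - 1) t ≥ 2 t`.
    have : (0 : ℝ) ≤ C.ncard := Nat.cast_nonneg _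
    nlinarith
  · rw [hcardN, hr]
    change _ < k ^ 2
    have : 0 < k ^ 2 := by positivity
    nlinarith

/-- A lower bound for the variance in terms of the size of the cap. -/
theorem IsCap.ncard_pow_le [Finite F] {C : Set (PG n F)} (hC : IsCap C) (hn : 1 ≤ n)
    (hq : 3 ≤ Nat.card F)
    (ht : 2 ^ 18 * (Nat.card F : ℝ) ^ (3 * n) ≤ Nat.card F * (C.ncard : ℝ) ^ 4) :
    (C.ncard : ℝ) ^ 6 * Nat.card F ≤ 4 * (varSecantCount C * (Nat.card F : ℝ) ^ (5 * n)) := by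
  classical
  have := Fintype.ofFinite F
  rw [Nat.card_eq_fintype_card] at *
  have hk := card_cone C
  have hmain := hC.card_cone_pow_le hq
  set k : ℝ := ((cone C).card : ℝ)
  set t : ℝ := (C.ncard : ℝ)
  have hq3 : (3 : ℝ) ≤ Fintype.card F := by exact_mod_cast hq
  set q : ℝ := (Fintype.card F : ℝ)
  have ht0 : 0 ≤ t := Nat.cast_nonneg _
  have hk2 : t * q / 2 ≤ k := by rw [hk]; nlinarith
  have hq0 : 0 < q := by linarith
  have htq : 0 ≤ t * q / 2 := by positivity
  have hv := varSecantCount_nonneg C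
  have h4 : 16 * (q ^ (n + 1)) ^ 3 ≤ (t * q / 2) ^ 4 := by
    have h1 : 0 ≤ q ^ (3 * n) * q ^ 3 := by positivity
    calc 16 * (q ^ (n + 1)) ^ 3 = 16 * (q ^ (3 * n) * q ^ 3) := by ring
      _ ≤ 2 ^ 18 * q ^ (3 * n) * q ^ 3 / 16 := by nlinarith
      _ ≤ q * t ^ 4 * q ^ 3 / 16 := by gcongr
      _ = _ := by ring
  have h2 : 8 * q ^ (n + 1) * q ≤ (t * q / 2) ^ 2 := by
    refine (pow_le_pow_iff_left₀ (by positivity) (by positivity) two_ne_zero).1 ?_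
    have h1 : q ^ (2 * n) * q ≤ q ^ (3 * n) := by
      rw [← pow_succ]; exact pow_le_pow_right₀ (by linarith) (by omega)
    have h3 : 0 ≤ q ^ (3 * n) * q ^ 3 := by positivity
    calc (8 * q ^ (n + 1) * q) ^ 2 = 64 * (q ^ (2 * n) * q * q ^ 3) := by ring
      _ ≤ 64 * (q ^ (3 * n) * q ^ 3) := by gcongr
      _ ≤ 2 ^ 18 * q ^ (3 * n) * q ^ 3 / 16 := by nlinarith
      _ ≤ q * t ^ 4 * q ^ 3 / 16 := by gcongr
      _ = _ := by ring
  have h10 := hmain (h2.trans (by gcongr)) (h4.trans (by gcongr))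
  have hle : (t * q / 2) ^ 10 ≤ 1024 * (q ^ (n + 1)) ^ 8 * varSecantCount C :=
    le_trans (by gcongr) h10
  -- The size hypothesis trades four of the ten factors `t` for `q^(3n)`. The constant `2 ^ 18`
  -- leaves exactly `2 ^ 20 / 2 ^ 18 = 4`, matching the `1/4` in the variance hypothesis of the
  -- first assertion.
  have hfin : 2 ^ 18 * q ^ (3 * n) * (t ^ 6 * q ^ 9) ≤
      2 ^ 20 * q ^ (3 * n) * q ^ 8 * (varSecantCount C * q ^ (5 * n)) := by
    calc 2 ^ 18 * q ^ (3 * n) * (t ^ 6 * q ^ 9) ≤ q * t ^ 4 * (t ^ 6 * q ^ 9) := by gcongr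
      _ = 1024 * (t * q / 2) ^ 10 := by ring
      _ ≤ 1024 * (1024 * (q ^ (n + 1)) ^ 8 * varSecantCount C) := by gcongr
      _ = _ := by ring
  have hpos : 0 < 2 ^ 18 * q ^ (3 * n) * q ^ 8 := by positivity
  refine le_of_mul_le_mul_left ?_ hpos
  linarith

end Variance

end CapBound

namespace CapBound

/-! ### Asymptotic form -/

section Asymptotic

/-- A cap size of order at least `q ^ (5n/6 - 1/6)` eventually satisfies `2 ^ 18 q ^ (3n) ≤ q t ^ 4`. -/
lemma eventually_le_mul_pow_four {ι : Type*} {l : Filter ι} {q n t : ι → ℕ} (hq : ∀ i, 0 < q i)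
    (hlim : Tendsto (fun i => (q i : ℝ) ^ (((n i : ℝ) + 1) / 3)) l atTop)
    (ht : (fun i => (q i : ℝ) ^ (5 / 6 * (n i : ℝ) - 1 / 6)) =O[l] (fun i => (t i : ℝ))) :
    ∀ᶠ i in l, 2 ^ 18 * (q i : ℝ) ^ (3 * n i) ≤ q i * (t i : ℝ) ^ 4 := by
  obtain ⟨c, hc, hbound⟩ := ht.exists_pos
  filter_upwards [hbound.bound, hlim.eventually_ge_atTop (2 ^ 18 * c ^ 4)] with i hi hN
  have hq0 : (0 : ℝ) < q i := by exact_mod_cast hq i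
  rw [Real.norm_of_nonneg (by positivity), Real.norm_of_nonneg (by positivity)] at hi
  -- The exponents satisfy `4 (5n/6 - 1/6) + 1 = 3n + (n + 1)/3`; the surplus `q^((n+1)/3)` tends to
  -- infinity and beats any implied constant.
  have h4 : ((q i : ℝ) ^ (5 / 6 * (n i : ℝ) - 1 / 6)) ^ 4 * q i =
      (q i : ℝ) ^ (3 * n i) * (q i : ℝ) ^ (((n i : ℝ) + 1) / 3) := by
    rw [← Real.rpow_natCast, ← Real.rpow_natCast, ← Real.rpow_mul hq0.le,
      ← Real.rpow_add hq0, ← Real.rpow_add_one hq0.ne']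
    congr 1
    push_cast
    ring
  have h : 2 ^ 18 * (q i : ℝ) ^ (3 * n i) * c ^ 4 ≤ q i * (t i : ℝ) ^ 4 * c ^ 4 := by
    calc _ = (q i : ℝ) ^ (3 * n i) * (2 ^ 18 * c ^ 4) := by ring
      _ ≤ (q i : ℝ) ^ (3 * n i) * (q i : ℝ) ^ (((n i : ℝ) + 1) / 3) := by gcongr
      _ = ((q i : ℝ) ^ (5 / 6 * (n i : ℝ) - 1 / 6)) ^ 4 * q i := h4.symm
      _ ≤ (c * t i) ^ 4 * q i := by gcongr
      _ = _ := by ring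
  exact le_of_mul_le_mul_right h (by positivity)

lemma IsCap.sq_le_varSecantCount {n : ℕ} {F : Type*} [Field F] [Finite F] {C : Set (PG n F)}
    (hC : IsCap C) (hn : 1 ≤ n) (hq : 3 ≤ Nat.card F)
    (ht : 2 ^ 18 * (Nat.card F : ℝ) ^ (3 * n) ≤ Nat.card F * (C.ncard : ℝ) ^ 4) :
    ((C.ncard : ℝ) ^ 3 * (Nat.card F : ℝ) ^ (-(5 / 2) * (n : ℝ) + 1 / 2)) ^ 2 ≤
      4 * varSecantCount C := by
  have h := hC.ncard_pow_le hn hq ht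
  have hq0 : (0 : ℝ) < Nat.card F := by exact_mod_cast (by omega : 0 < Nat.card F)
  have hpow : ((Nat.card F : ℝ) ^ (-(5 / 2) * (n : ℝ) + 1 / 2)) ^ 2 * (Nat.card F : ℝ) ^ (5 * n) =
      Nat.card F := by
    rw [← Real.rpow_natCast, ← Real.rpow_natCast, ← Real.rpow_mul hq0.le, ← Real.rpow_add hq0]
    conv_rhs => rw [← Real.rpow_one (Nat.card F : ℝ)]
    congr 1
    push_cast
    ring
  refine le_of_mul_le_mul_right ?_ (pow_pos hq0 (5 * n))
  calc _ = (C.ncard : ℝ) ^ 6 * (((Nat.card F : ℝ) ^ (-(5 / 2) * (n : ℝ) + 1 / 2)) ^ 2 *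
        (Nat.card F : ℝ) ^ (5 * n)) := by ring
    _ ≤ _ := by rw [hpow]; linarith

end Asymptotic

end CapBound

theorem mainTheorem8 :
    -- (i): `n ≥ 4` is fixed and `q → ∞`
    (∀ (n : ℕ), 4 ≤ n →
      ∀ {ι : Type*} (l : Filter ι) (F : ι → Type*) [∀ i, Field (F i)] [∀ i, Finite (F i)]
        (q : ι → ℕ) (C : ∀ i, Set (CapBound.PG n (F i))) (t : ι → ℕ) (σ : ι → ℝ),
        (∀ i, q i = Nat.card (F i)) →
        (∀ i, CapBound.IsCap (C i)) →
        (∀ i, t i = (C i).ncard) →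
        (∀ i, 0 ≤ σ i) →
        Tendsto q l atTop →
        -- `t = Ω(q ^ (5n/6 - 1/6))`
        (fun i => (q i : ℝ) ^ (5 / 6 * (n : ℝ) - 1 / 6)) =O[l] (fun i => (t i : ℝ)) →
        -- `Var(h_p) ≤ (1/4 + o(1)) σ²`
        (∃ ε : ι → ℝ, Tendsto ε l (𝓝 0) ∧
          ∀ᶠ i in l, CapBound.varSecantCount (C i) ≤ (1 / 4 + ε i) * σ i ^ 2) →
        -- `σ ≥ (1 + o(1)) t³ q ^ (-5n/2 + 1/2)`
        ∃ ε : ι → ℝ, Tendsto ε l (𝓝 0) ∧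
          ∀ᶠ i in l,
            (1 + ε i) * ((t i : ℝ) ^ 3 * (q i : ℝ) ^ (-(5 / 2) * (n : ℝ) + 1 / 2)) ≤ σ i) ∧
    -- (ii): `q ≥ 3` is fixed and `n → ∞`
    (∀ (F : Type*) [Field F] [Finite F] (q : ℕ), q = Nat.card F → 3 ≤ q →
      ∀ {ι : Type*} (l : Filter ι) (n : ι → ℕ)
        (C : ∀ i, Set (CapBound.PG (n i) F)) (t : ι → ℕ) (σ : ι → ℝ),
        (∀ i, CapBound.IsCap (C i)) →
        (∀ i, t i = (C i).ncard) →
        (∀ i, 0 ≤ σ i) →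
        Tendsto n l atTop →
        -- `t = Ω(q ^ (5n/6 - 1/6))`
        (fun i => (q : ℝ) ^ (5 / 6 * (n i : ℝ) - 1 / 6)) =O[l] (fun i => (t i : ℝ)) →
        -- `Var(h_p) = Θ(σ²)`
        (fun i => CapBound.varSecantCount (C i)) =Θ[l] (fun i => σ i ^ 2) →
        -- `σ = Ω(t³ q ^ (-5n/2))`
        (fun i => (t i : ℝ) ^ 3 * (q : ℝ) ^ (-(5 / 2) * (n i : ℝ))) =O[l] σ) := by
  refine ⟨?_, ?_⟩
  · intro n hn ι l F _ _ q C t σ hq hC ht hσ hlim hΩ ⟨ε, hε, hvar⟩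
    have hq0 : ∀ i, 0 < q i := fun i => hq i ▸ Nat.card_pos
    have hN : Tendsto (fun i => (q i : ℝ) ^ (((n : ℝ) + 1) / 3)) l atTop :=
      (tendsto_rpow_atTop (by positivity)).comp (tendsto_natCast_atTop_atTop.comp hlim)
    have hsize := CapBound.eventually_le_mul_pow_four (n := fun _ => n) hq0 hN hΩ
    -- The explicit bound and the hypothesis combine to `(t³ q^(-5n/2 + 1/2))² ≤ 4 Var ≤ (1 + 4 ε)
    -- σ²`, which dictates this factor.
    refine ⟨fun i => (√(1 + 4 * ε i))⁻¹ - 1, ?_, ?_⟩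
    · have h : Tendsto (fun i => (√(1 + 4 * ε i))⁻¹ - 1) l (𝓝 ((√(1 + 4 * 0))⁻¹ - 1)) :=
        (((hε.const_mul 4).const_add 1).sqrt.inv₀ (by simp)).sub_const 1
      simpa using h
    · filter_upwards [hsize, hvar, hlim.eventually_ge_atTop 3,
        hε.eventually (lt_mem_nhds (show (-(1 / 4) : ℝ) < 0 by norm_num))] with i hi hv hq3 hεi
      rw [ht i, hq i] at hi
      have h := (hC i).sq_le_varSecantCount (by omega) (hq i ▸ hq3) hi
      rw [← ht i, ← hq i] at h
      have hpos : 0 < 1 + 4 * ε i := by linarith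
      rw [add_sub_cancel, inv_mul_le_iff₀ (Real.sqrt_pos.2 hpos)]
      refine le_of_sq_le_sq ?_ (mul_nonneg (Real.sqrt_nonneg _) (hσ i))
      rw [mul_pow (√_), Real.sq_sqrt hpos.le]
      linarith
  · intro F _ _ q hq hq3 ι l n C t σ hC ht hσ hlim hΩ hΘ
    have hq1 : (1 : ℝ) < q := by exact_mod_cast (by omega : 1 < q)
    have hN : Tendsto (fun i => (q : ℝ) ^ (((n i : ℝ) + 1) / 3)) l atTop :=
      (tendsto_rpow_atTop_of_base_gt_one _ hq1).comp
        ((tendsto_atTop_add_const_right l 1 (tendsto_natCast_atTop_atTop.comp hlim)).atTop_div_const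
          (by norm_num))
    have hsize := CapBound.eventually_le_mul_pow_four (q := fun _ => q) (fun _ => by omega) hN hΩ
    obtain ⟨K, hK, hbound⟩ := hΘ.1.exists_pos
    refine IsBigO.of_bound (√(4 * K)) ?_
    filter_upwards [hsize, hbound.bound, hlim.eventually_ge_atTop 1] with i hi hv hn1
    rw [ht i, hq] at hi
    have h := (hC i).sq_le_varSecantCount hn1 (hq ▸ hq3) hi
    rw [← ht i, ← hq] at h
    have hv' : CapBound.varSecantCount (C i) ≤ K * σ i ^ 2 := by
      refine (Real.le_norm_self _).trans (hv.trans_eq ?_)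
      rw [Real.norm_of_nonneg (sq_nonneg _)]
    rw [Real.norm_of_nonneg (by positivity), Real.norm_of_nonneg (hσ i)]
    -- For fixed `q` the factor `q^(1/2)` is a constant and is discarded.
    have hle : (t i : ℝ) ^ 3 * (q : ℝ) ^ (-(5 / 2) * (n i : ℝ)) ≤
        (t i : ℝ) ^ 3 * (q : ℝ) ^ (-(5 / 2) * (n i : ℝ) + 1 / 2) := by
      gcongr
      · exact hq1.le
      · linarith
    refine hle.trans (le_of_sq_le_sq ?_ (mul_nonneg (Real.sqrt_nonneg _) (hσ i)))
    rw [mul_pow (√_), Real.sq_sqrt (by positivity)]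
    linarith
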